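/- **Theorem.** Let $N\ge 0$ be an integer, $b\in\mathbb R$, and let $p_i,\xi_{i0}\in\mathbb C$ ($1\le i\le 2N$) satisfy $p_i\neq 0$, $1\pm bp_i\neq0$ for all $i$, $p_i+p_j\neq 0$ for $i\ne j$, and the reduction condition $$p_i^3\,(1-b^2p_{2N+1-i}^2)=-\,p_{2N+1-i}^3\,(1-b^2p_i^2),\qquad i=1,\dots,2N .$$ Let $c_{ij}\in\mathbb C$ be constants with $c_{ij}=-c_{ji}$ and $c_{ij}=0$ unless $j=2N+1-i$. For $l\in\mathbb Z$ and $s\in\mathbb R$ put $$\varphi_i(l)=\Big(\frac{1+bp_i}{1-bp_i}\Big)^{l}e^{s/p_i+\xi_{i0}},\qquad (i,j)_l=c_{ij}+\frac{p_i-p_j}{p_i+p_j}\,\varphi_i(l)\varphi_j(l),\qquad \tau_l=\operatorname{Pf}\big((i,j)_l\big)_{1\le i,j\le 2N},$$ $$u_l=-2(\ln\tau_l)_{ss},\qquad x_l=2lb-2(\ln\tau_l)_s,\qquad \delta_l=x_{l+1}-x_l ,$$ where $(\ln\tau_l)_s=\tau_l'/\tau_l$. For sequences $v_l$ write $\Delta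 v_l=(v_{l+1}-v_l)/\delta_l$ and $Mv_l=(v_l+v_{l-1})/2$. (1) For every $l\in\mathbb Z$ and every $s$ at which $\tau_{l-1},\tau_l,\tau_{l+1}$, $\delta_{l-1},\delta_l$ and $\delta_{l-1}+\delta_l$ do not vanish, the semi-discrete short-wave Degasperis–Procesi system holds: $$\frac{dm_l}{ds}=m_l\Big(-2M\Delta u_l-\frac{M(\delta_l\Delta u_l)}{M\delta_l}+\frac12(\delta_l-\delta_{l-1})\Big),\qquad \frac{d\delta_l}{ds}=u_{l+1}-u_l,$$ $$m_l=\frac{2}{\delta_l+\delta_{l-1}}\big(-\Delta u_l+\Delta u_{l-1}\big)+1 .$$ (2) For every $l\in\mathbb Z$ and every $s$ at which $\tau_l$ and $\tau_{l+1}$ do not vanish, the semi-discrete reduced Ostrovsky system holds: $$\frac{d}{ds}(u_{l+1}-u_l)=\frac32\,\delta_l(u_l+u_{l+1})-\frac14\,\delta_l(\delta_l^2-4b^2),\qquad \frac{d\delta_l}{ds}=u_{l+1}-u_l .$$ -/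

import Mathlib

noncomputable section

namespace ShortWaveDP

/-- The Pfaffian of an antisymmetric `2N × 2N` matrix,
`Pf A = (2 ^ N N!)⁻¹ ∑ σ, sgn σ ∏ i, A (σ (2i), σ (2i+1))` (rows and columns numbered from `0`). -/
def pfaffian {N : ℕ} (A : Matrix (Fin (2 * N)) (Fin (2 * N)) ℂ) : ℂ :=
  ((2 : ℂ) ^ N * (Nat.factorial N : ℂ))⁻¹ *
    ∑ σ : Equiv.Perm (Fin (2 * N)), ((Equiv.Perm.sign σ : ℤ) : ℂ) *
      ∏ i : Fin N, A (σ ⟨2 * (i : ℕ), by omega⟩) (σ ⟨2 * (i : ℕ) + 1, by omega⟩)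

/-- `φ_i(l) = ((1 + b p_i) / (1 - b p_i)) ^ l * exp (s / p_i + ξ_{i0})`. -/
def phi {N : ℕ} (b : ℝ) (p ξ : Fin (2 * N) → ℂ) (i : Fin (2 * N)) (l : ℤ) (s : ℝ) : ℂ :=
  ((1 + (b : ℂ) * p i) / (1 - (b : ℂ) * p i)) ^ l * Complex.exp ((p i)⁻¹ * (s : ℂ) + ξ i)

/-- `τ_l(s) = Pf (1, …, 2N)_l` with the entries
`(i, j)_l = c_{ij} + (p_i - p_j) / (p_i + p_j) * φ_i(l) φ_j(l)`. -/
def tau {N : ℕ} (b : ℝ) (p ξ : Fin (2 * N) → ℂ) (c : Matrix (Fin (2 * N)) (Fin (2 * N)) ℂ)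
    (l : ℤ) (s : ℝ) : ℂ :=
  pfaffian (Matrix.of fun i j =>
    c i j + (p i - p j) / (p i + p j) * (phi b p ξ i l s * phi b p ξ j l s))

/-- `u_l = -2 (ln τ_l)_{ss}`; the derivative `(ln τ_l)_s` is the logarithmic derivative
`τ_l' / τ_l`. -/
def uOf (τ : ℤ → ℝ → ℂ) (l : ℤ) (s : ℝ) : ℂ := -2 * deriv (logDeriv (τ l)) s

/-- `x_l = 2 l b - 2 (ln τ_l)_s`. -/
def xOf (b : ℝ) (τ : ℤ → ℝ → ℂ) (l : ℤ) (s : ℝ) : ℂ :=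
  2 * (l : ℂ) * (b : ℂ) - 2 * logDeriv (τ l) s

/-- The mesh `δ_l = x_{l+1} - x_l`. -/
def meshOf (x : ℤ → ℝ → ℂ) (l : ℤ) (s : ℝ) : ℂ := x (l + 1) s - x l s

/-- The difference operator `Δ u_l = (u_{l+1} - u_l) / δ_l`. -/
def diffOp (δ u : ℤ → ℝ → ℂ) (l : ℤ) (s : ℝ) : ℂ := (u (l + 1) s - u l s) / δ l s

/-- The average operator `M v_l = (v_l + v_{l-1}) / 2`. -/
def avgOp (v : ℤ → ℝ → ℂ) (l : ℤ) (s : ℝ) : ℂ := (v l s + v (l - 1) s) / 2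

/-- `m_l = 1 + 2 / (δ_l + δ_{l-1}) * (-Δ u_l + Δ u_{l-1})`. -/
def mOf (δ u : ℤ → ℝ → ℂ) (l : ℤ) (s : ℝ) : ℂ :=
  2 / (δ l s + δ (l - 1) s) * (-diffOp δ u l s + diffOp δ u (l - 1) s) + 1

/-- The semi-discrete short wave limit of the Degasperis-Procesi equation for `m, δ, u`,
at the site `l` and the time `s`. -/
def SolvesDPAt (m δ u : ℤ → ℝ → ℂ) (l : ℤ) (s : ℝ) : Prop :=
  HasDerivAt (m l)
    (m l s * (-2 * avgOp (diffOp δ u) l s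
      - avgOp (fun k t => δ k t * diffOp δ u k t) l s / avgOp δ l s
      + (1 / 2) * (δ l s - δ (l - 1) s))) s ∧
  HasDerivAt (δ l) (u (l + 1) s - u l s) s ∧
  m l s = 2 / (δ l s + δ (l - 1) s) * (-diffOp δ u l s + diffOp δ u (l - 1) s) + 1

/-- The semi-discrete reduced Ostrovsky equation for `δ, u` with mesh parameter `b`,
at the site `l` and the time `s`. -/
def SolvesOstrovskyAt (b : ℝ) (δ u : ℤ → ℝ → ℂ) (l : ℤ) (s : ℝ) : Prop :=
  HasDerivAt (fun t => u (l + 1) t - u l t)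
    (3 / 2 * δ l s * (u l s + u (l + 1) s)
      - 1 / 4 * δ l s * ((δ l s) ^ 2 - 4 * (b : ℂ) ^ 2)) s ∧
  HasDerivAt (δ l) (u (l + 1) s - u l s) s

end ShortWaveDP

end

/-!
# Soliton solutions of the semi-discrete Degasperis-Procesi and reduced Ostrovsky equations

Write `A` for the skew matrix of entries `(i, j)_l`, so that `τ_l = Pf A`, put `k_i = 1 / p_i`, and
let `⟨x, y⟩ = xᵀ A⁻¹ y`, a skew-symmetric form. Two rank two formulas govern everything:

* in the time `s`, `A' = φ φ'ᵀ - φ' φᵀ` (`IsReduced.hasDerivAt_tauMatrix`);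
* in the site `l`, `A_{l+1} = A_l + 2 b (α φᵀ - φ αᵀ)` with `α_i = φ_i / (k_i - b)`
  (`IsReduced.tauMatrix_succ`).

Since `Pf (A + x yᵀ - y xᵀ) = Pf A (1 - ⟨x, y⟩)` (`pfaffian_add_wedge`, a consequence of
`Pf (B A Bᵀ) = det B Pf A`), these give `(ln τ_l)' = -⟨φ, φ'⟩` and
`R = τ_{l+1} / τ_l = 1 - 2 b ⟨α, φ⟩`. The form itself is differentiated by `hasDerivAt_bracket`, so
that all derivatives of `R` and of `F = (ln τ_l)''` are polynomials in `b` and the numbers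
`⟨φ⁽ᵐ⁾, φ⁽ⁿ⁾⟩` and `⟨α, φ⁽ⁿ⁾⟩`.

The reduction condition says that `h = k³ - b² k` satisfies `h_i + h_{2N+1-i} = 0`. Hence
`diag h * A + A * diag h` does not contain the constants `c_{ij}` and has rank at most four
(`IsReduced.dispersion_tauMatrix`), which expresses `⟨α, φ'''⟩` by the other numbers
(`IsReduced.bracket_shiftVec`). Inserting this into `R'''` yields the bilinear equation
`(D³ - 3 b D² + 2 b² D) τ_{l+1} · τ_l = 0`, in the form
`R''' + 6 F R' - 3 b (R'' + 2 F R) + 2 b² R' = 0` (`IsReduced.hasDerivAt_shiftDeriv₂`).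

As `δ_l = 2 b - 2 R' / R`, this is the Ostrovsky equation at the site `l`. The Degasperis-Procesi
system at `l` is an algebraic consequence of the Ostrovsky equations at `l - 1` and `l`
(`SolvesOstrovskyAt.solvesDPAt`).
-/

namespace ShortWaveDP

open Matrix Equiv Filter Topology

/-! ### Pfaffians -/

/-- The decomposition of `{0, …, 2N - 1}` into the `N` pairs `{2i, 2i + 1}`. -/
def pairEquiv (N : ℕ) : Fin N × Fin 2 ≃ Fin (2 * N) :=
  finProdFinEquiv.trans (finCongr (Nat.mul_comm N 2))

lemma pairEquiv_zero {N : ℕ} (i : Fin N) : pairEquiv N (i, 0) = ⟨2 * (i : ℕ), by omega⟩ := by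
  ext; simp [pairEquiv]

lemma pairEquiv_one {N : ℕ} (i : Fin N) : pairEquiv N (i, 1) = ⟨2 * (i : ℕ) + 1, by omega⟩ := by
  ext; simp [pairEquiv]; omega

lemma prod_eq_prod_pairs {N : ℕ} (F : Fin (2 * N) → ℂ) :
    ∏ j, F j = ∏ i : Fin N, F (pairEquiv N (i, 0)) * F (pairEquiv N (i, 1)) := by
  rw [← (pairEquiv N).prod_comp, Fintype.prod_prod_type]
  simp [Fin.prod_univ_two]

lemma pfaffian_eq {N : ℕ} (A : Matrix (Fin (2 * N)) (Fin (2 * N)) ℂ) :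
    pfaffian A = ((2 : ℂ) ^ N * (Nat.factorial N : ℂ))⁻¹ *
      ∑ σ : Perm (Fin (2 * N)), ((Perm.sign σ : ℤ) : ℂ) *
        ∏ i : Fin N, A (σ (pairEquiv N (i, 0))) (σ (pairEquiv N (i, 1))) := by
  simp only [pfaffian, pairEquiv_zero, pairEquiv_one]

/-- A function on `{0, …, 2N - 1}` as the sequence of its values on the pairs `(2i, 2i + 1)`. -/
def pairFunEquiv (N : ℕ) (α : Type*) : (Fin (2 * N) → α) ≃ (Fin N → α × α) :=
  ((pairEquiv N).arrowCongr (Equiv.refl α)).symm.trans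
    ((Equiv.curry _ _ _).trans ((Equiv.refl _).arrowCongr (finTwoArrowEquiv α)))

lemma pairFunEquiv_apply {N : ℕ} {α : Type*} (f : Fin (2 * N) → α) (i : Fin N) :
    pairFunEquiv N α f i = (f (pairEquiv N (i, 0)), f (pairEquiv N (i, 1))) := by
  simp [pairFunEquiv, finTwoArrowEquiv, Equiv.arrowCongr]

lemma prod_conj_apply {N : ℕ} (A B : Matrix (Fin (2 * N)) (Fin (2 * N)) ℂ)
    (σ : Perm (Fin (2 * N))) :
    ∏ i : Fin N, (B * A * Bᵀ) (σ (pairEquiv N (i, 0))) (σ (pairEquiv N (i, 1))) =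
      ∑ f : Fin (2 * N) → Fin (2 * N), (∏ j, B (σ j) (f j)) *
        ∏ i : Fin N, A (f (pairEquiv N (i, 0))) (f (pairEquiv N (i, 1))) := by
  have h : ∀ x y, (B * A * Bᵀ) x y =
      ∑ q : Fin (2 * N) × Fin (2 * N), B x q.1 * B y q.2 * A q.1 q.2 := by
    intro x y
    simp only [mul_apply, transpose_apply, Finset.sum_mul, Fintype.sum_prod_type]
    rw [Finset.sum_comm]
    exact Finset.sum_congr rfl fun a _ => Finset.sum_congr rfl fun b _ => by ring
  simp only [h, Finset.prod_univ_sum, Fintype.piFinset_univ]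
  rw [← (pairFunEquiv N (Fin (2 * N))).sum_comp]
  refine Finset.sum_congr rfl fun f _ => ?_
  simp only [pairFunEquiv_apply, Finset.prod_mul_distrib, prod_eq_prod_pairs]

lemma sum_sign_prod_eq_det {n : ℕ} (B : Matrix (Fin n) (Fin n) ℂ) (f : Fin n → Fin n) :
    ∑ σ : Perm (Fin n), ((Perm.sign σ : ℤ) : ℂ) * ∏ j, B (σ j) (f j) =
      (B.submatrix id f).det := by
  simp [det_apply']

/-- The Pfaffian is multiplied by `det B` under the congruence by `B`. -/
theorem pfaffian_conj {N : ℕ} (A B : Matrix (Fin (2 * N)) (Fin (2 * N)) ℂ) :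
    pfaffian (B * A * Bᵀ) = B.det * pfaffian A := by
  have key : ∑ σ : Perm (Fin (2 * N)), ((Perm.sign σ : ℤ) : ℂ) *
        ∏ i : Fin N, (B * A * Bᵀ) (σ (pairEquiv N (i, 0))) (σ (pairEquiv N (i, 1))) =
      ∑ f : Fin (2 * N) → Fin (2 * N), (B.submatrix id f).det *
        ∏ i : Fin N, A (f (pairEquiv N (i, 0))) (f (pairEquiv N (i, 1))) := by
    simp only [prod_conj_apply, Finset.mul_sum]
    rw [Finset.sum_comm]
    refine Finset.sum_congr rfl fun f _ => ?_
    rw [← sum_sign_prod_eq_det, Finset.sum_mul]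
    exact Finset.sum_congr rfl fun σ _ => by ring
  rw [pfaffian_eq, key, pfaffian_eq, mul_left_comm]
  refine congrArg _ ?_
  rw [Finset.mul_sum]
  -- Only the injective `f`, that is the permutations, contribute to the sum.
  refine (Finset.sum_of_injOn (s := Finset.univ) (t := Finset.univ)
    (fun σ : Perm (Fin (2 * N)) => (σ : Fin (2 * N) → Fin (2 * N)))
    (fun _ _ _ _ h => DFunLike.coe_injective h) (fun _ _ => Finset.mem_coe.2 (Finset.mem_univ _))
    (fun f _ hf => ?_) (fun σ _ => ?_)).symm
  · have hni : ¬ Function.Injective f := fun hinj =>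
      hf ⟨Equiv.ofBijective f (Finite.injective_iff_bijective.1 hinj), by simp, rfl⟩
    obtain ⟨i, j, hij, hne⟩ : ∃ i j, f i = f j ∧ i ≠ j := by
      simpa [Function.Injective] using hni
    rw [det_zero_of_column_eq hne (fun r => by simp [hij]), zero_mul]
  · simp only [det_permute']
    ring

/-- The skew-symmetric matrix `x yᵀ - y xᵀ`. -/
def wedge {n : ℕ} (x y : Fin n → ℂ) : Matrix (Fin n) (Fin n) ℂ := vecMulVec x y - vecMulVec y x

/-- The form `⟨x, y⟩ = xᵀ A⁻¹ y`, skew-symmetric if `A` is; it is zero if `A` is singular. -/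
noncomputable def bracket {n : ℕ} (A : Matrix (Fin n) (Fin n) ℂ) (x y : Fin n → ℂ) : ℂ :=
  x ⬝ᵥ (A⁻¹ *ᵥ y)

lemma det_one_add_vecMulVec {n : ℕ} (u v : Fin n → ℂ) :
    (1 + vecMulVec u v).det = 1 + v ⬝ᵥ u := by
  rw [vecMulVec_eq Unit, det_one_add_replicateCol_mul_replicateRow]

/-- If `v ≠ 0` is in the kernel of the skew matrix `A`, then `B = 1 + x vᵀ` satisfies `B A Bᵀ = A`,
and `x` can be chosen such that `det B = 0`. -/
theorem isUnit_det_of_pfaffian_ne_zero {N : ℕ} {A : Matrix (Fin (2 * N)) (Fin (2 * N)) ℂ}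
    (hA : Aᵀ = -A) (h : pfaffian A ≠ 0) : IsUnit A.det := by
  rw [isUnit_iff_ne_zero]
  intro hdet
  obtain ⟨v, hv0, hv⟩ := exists_mulVec_eq_zero_iff.2 hdet
  obtain ⟨i, hi⟩ := Function.ne_iff.1 hv0
  have hv' : v ᵥ* A = 0 := by rw [← mulVec_transpose, hA, neg_mulVec, hv, neg_zero]
  set x : Fin (2 * N) → ℂ := Pi.single i (-(v i)⁻¹) with hx
  have hvx : v ⬝ᵥ x = -1 := by
    rw [hx, dotProduct_single]
    simpa using mul_inv_cancel₀ hi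
  have hconj : (1 + vecMulVec x v) * A * (1 + vecMulVec x v)ᵀ = A := by
    rw [add_mul, vecMulVec_mul, hv', transpose_add, transpose_vecMulVec, mul_add, add_mul, add_mul,
      mul_vecMulVec]
    simp [hv]
  have := pfaffian_conj A (1 + vecMulVec x v)
  rw [hconj, det_one_add_vecMulVec, hvx] at this
  simp at this
  exact h this

lemma transpose_inv_of_skew {n : ℕ} {A : Matrix (Fin n) (Fin n) ℂ} (hA : Aᵀ = -A) :
    (A⁻¹)ᵀ = -A⁻¹ := by
  rw [transpose_nonsing_inv, hA]
  by_cases h : IsUnit A.det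
  · refine inv_eq_left_inv ?_
    simp [nonsing_inv_mul A h]
  · have h' : ¬ IsUnit (-A).det := by
      rw [det_neg]
      rw [isUnit_iff_ne_zero] at h ⊢
      simpa using h
    rw [nonsing_inv_apply_not_isUnit _ h, nonsing_inv_apply_not_isUnit _ h', neg_zero]

lemma bracket_swap {n : ℕ} {A : Matrix (Fin n) (Fin n) ℂ} (hA : Aᵀ = -A) (x y : Fin n → ℂ) :
    bracket A x y = -bracket A y x := by
  unfold bracket
  rw [dotProduct_mulVec, ← mulVec_transpose, transpose_inv_of_skew hA, neg_mulVec, neg_dotProduct,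
    dotProduct_comm]

lemma bracket_self {n : ℕ} {A : Matrix (Fin n) (Fin n) ℂ} (hA : Aᵀ = -A) (x : Fin n → ℂ) :
    bracket A x x = 0 := by
  have := bracket_swap hA x x
  linear_combination this / 2

/-- A rank two perturbation is a congruence, by a matrix `1 + x zᵀ` with `A z = -y`. -/
theorem pfaffian_add_wedge {N : ℕ} {A : Matrix (Fin (2 * N)) (Fin (2 * N)) ℂ}
    (hA : Aᵀ = -A) (hdet : IsUnit A.det) (x y : Fin (2 * N) → ℂ) :
    pfaffian (A + wedge x y) = pfaffian A * (1 - bracket A x y) := by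
  set z : Fin (2 * N) → ℂ := -(A⁻¹ *ᵥ y) with hz
  have hAz : A *ᵥ z = -y := by
    rw [hz, mulVec_neg, mulVec_mulVec, mul_nonsing_inv A hdet, one_mulVec]
  have hzA : z ᵥ* A = y := by rw [← mulVec_transpose, hA, neg_mulVec, hAz, neg_neg]
  have hyz : y ⬝ᵥ z = 0 := by
    have := bracket_self hA y
    rw [hz, dotProduct_neg, ← bracket, this, neg_zero]
  have hconj : (1 + vecMulVec x z) * A * (1 + vecMulVec x z)ᵀ = A + wedge x y := by
    rw [add_mul, vecMulVec_mul, hzA, transpose_add, transpose_vecMulVec, mul_add, add_mul, add_mul,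
      mul_vecMulVec, vecMulVec_mul_vecMulVec, hyz, one_mul, hAz, wedge]
    simp
    abel
  rw [← hconj, pfaffian_conj, det_one_add_vecMulVec, hz, neg_dotProduct,
    dotProduct_comm, bracket]
  ring

/-! ### Differentiation of Pfaffians and of the skew-symmetric form -/

section Calculus

open scoped Matrix.Norms.Operator

lemma hasDerivAt_matrix {n : ℕ} {A : ℝ → Matrix (Fin n) (Fin n) ℂ} {A' : Matrix (Fin n) (Fin n) ℂ}
    {s : ℝ} (h : ∀ i j, HasDerivAt (fun t => A t i j) (A' i j) s) : HasDerivAt A A' s := by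
  have key : ∀ M : Matrix (Fin n) (Fin n) ℂ,
      M = ∑ i, ∑ j, M i j • single i j (1 : ℂ) := by
    intro M
    conv_lhs => rw [matrix_eq_sum_single M]
    simp [smul_single]
  rw [key A', funext fun t => key (A t)]
  exact HasDerivAt.fun_sum fun i _ => HasDerivAt.fun_sum fun j _ => (h i j).smul_const _

lemma hasDerivAt_matrix_apply {n : ℕ} {A : ℝ → Matrix (Fin n) (Fin n) ℂ}
    {A' : Matrix (Fin n) (Fin n) ℂ} {s : ℝ} (h : HasDerivAt A A' s) (i j : Fin n) :
    HasDerivAt (fun t => A t i j) (A' i j) s :=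
  (entryLinearMap ℝ ℂ i j).toContinuousLinearMap.hasFDerivAt.comp_hasDerivAt s h

lemma differentiable_pfaffian {N : ℕ} :
    Differentiable ℝ (pfaffian : Matrix (Fin (2 * N)) (Fin (2 * N)) ℂ → ℂ) := by
  have h : ∀ i j, Differentiable ℝ fun A : Matrix (Fin (2 * N)) (Fin (2 * N)) ℂ => A i j :=
    fun i j => (entryLinearMap ℝ ℂ i j).toContinuousLinearMap.differentiable
  unfold pfaffian
  fun_prop

/-- The derivative of the Pfaffian in the direction `x yᵀ - y xᵀ` is read off from
`pfaffian_add_wedge`, by which the Pfaffian is affine along that line. -/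
theorem hasDerivAt_pfaffian {N : ℕ} {A : ℝ → Matrix (Fin (2 * N)) (Fin (2 * N)) ℂ}
    {x y : Fin (2 * N) → ℂ} {s : ℝ} (hA : (A s)ᵀ = -A s) (hdet : IsUnit (A s).det)
    (h : ∀ i j, HasDerivAt (fun t => A t i j) (wedge x y i j) s) :
    HasDerivAt (fun t => pfaffian (A t)) (-bracket (A s) x y * pfaffian (A s)) s := by
  have hd := (differentiable_pfaffian (N := N) (A s)).hasFDerivAt
  have h1 := hd.comp_hasDerivAt s (hasDerivAt_matrix h)
  have hline : HasDerivAt (fun ε : ℝ => A s + ε • wedge x y) (wedge x y) 0 :=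
    (((hasDerivAt_id' (0 : ℝ)).smul_const (wedge x y)).const_add (A s)).congr_deriv
      (one_smul _ _)
  have hd0 : HasFDerivAt pfaffian (fderiv ℝ pfaffian (A s)) (A s + (0 : ℝ) • wedge x y) := by
    simpa using hd
  have h2 := hd0.comp_hasDerivAt (0 : ℝ) hline
  have heq : (pfaffian ∘ fun ε : ℝ => A s + ε • wedge x y) =
      fun ε : ℝ => pfaffian (A s) * (1 - (ε : ℂ) * bracket (A s) x y) := by
    funext ε
    have hw : ε • wedge x y = wedge ((ε : ℂ) • x) y := by
      ext i j
      simp [wedge, vecMulVec_apply]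
      ring
    have hb : bracket (A s) ((ε : ℂ) • x) y = (ε : ℂ) * bracket (A s) x y := by
      simp [bracket]
    rw [Function.comp_apply, hw, pfaffian_add_wedge hA hdet, hb]
  rw [heq] at h2
  have h3 : HasDerivAt (fun ε : ℝ => pfaffian (A s) * (1 - (ε : ℂ) * bracket (A s) x y))
      (pfaffian (A s) * -(1 * bracket (A s) x y)) 0 :=
    (((HasDerivAt.ofReal_comp (hasDerivAt_id (0 : ℝ))).mul_const _).const_sub 1).const_mul _
  have h4 := h2.unique h3
  rw [h4] at h1
  exact h1.congr_deriv (by ring)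

lemma hasDerivAt_inv_matrix {n : ℕ} {A : ℝ → Matrix (Fin n) (Fin n) ℂ}
    {A' : Matrix (Fin n) (Fin n) ℂ} {s : ℝ} (hdet : IsUnit (A s).det)
    (h : HasDerivAt A A' s) :
    HasDerivAt (fun t => (A t)⁻¹) (-((A s)⁻¹ * A' * (A s)⁻¹)) s := by
  obtain ⟨u, hu⟩ := (isUnit_iff_isUnit_det _).2 hdet
  have h1 : HasFDerivAt Ring.inverse
      (-ContinuousLinearMap.mulLeftRight ℝ (Matrix (Fin n) (Fin n) ℂ) ↑u⁻¹ ↑u⁻¹) (A s) := by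
    rw [← hu]
    exact hasFDerivAt_ringInverse u
  have h2 := h1.comp_hasDerivAt s h
  have h3 : (Ring.inverse ∘ A) = fun t => (A t)⁻¹ := by
    funext t
    rw [Function.comp_apply, nonsing_inv_eq_ringInverse]
  rw [h3] at h2
  refine h2.congr_deriv ?_
  rw [← hu, ← coe_units_inv]
  simp

lemma bracket_eq_sum {n : ℕ} (A : Matrix (Fin n) (Fin n) ℂ) (x y : Fin n → ℂ) :
    bracket A x y = ∑ i, ∑ j, x i * (A⁻¹ i j * y j) := by
  simp [bracket, dotProduct, mulVec, Finset.mul_sum]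

lemma bracket_add_left {n : ℕ} (A : Matrix (Fin n) (Fin n) ℂ) (x y z : Fin n → ℂ) :
    bracket A (x + y) z = bracket A x z + bracket A y z := by simp [bracket]

lemma bracket_sub_right {n : ℕ} (A : Matrix (Fin n) (Fin n) ℂ) (x y z : Fin n → ℂ) :
    bracket A x (y - z) = bracket A x y - bracket A x z := by simp [bracket, mulVec_sub]

lemma bracket_smul_left {n : ℕ} (A : Matrix (Fin n) (Fin n) ℂ) (r : ℂ) (x y : Fin n → ℂ) :
    bracket A (r • x) y = r * bracket A x y := by simp [bracket]

lemma bracket_smul_right {n : ℕ} (A : Matrix (Fin n) (Fin n) ℂ) (r : ℂ) (x y : Fin n → ℂ) :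
    bracket A x (r • y) = r * bracket A x y := by simp [bracket, mulVec_smul]

lemma dotProduct_inv_wedge_inv {n : ℕ} {A : Matrix (Fin n) (Fin n) ℂ} (x y u v : Fin n → ℂ) :
    x ⬝ᵥ ((A⁻¹ * wedge u v * A⁻¹) *ᵥ y) =
      bracket A x u * bracket A v y - bracket A x v * bracket A u y := by
  have h : ∀ a b c d : Fin n → ℂ, a ⬝ᵥ (A⁻¹ *ᵥ (vecMulVec b c *ᵥ d)) =
      bracket A a b * (c ⬝ᵥ d) := by
    intro a b c d
    rw [vecMulVec_mulVec, bracket]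
    simp [mulVec_smul, mul_comm]
  rw [← mulVec_mulVec, ← mulVec_mulVec, wedge, sub_mulVec, mulVec_sub, dotProduct_sub, h, h]
  rfl

theorem hasDerivAt_bracket {n : ℕ} {A : ℝ → Matrix (Fin n) (Fin n) ℂ}
    {x y : ℝ → Fin n → ℂ} {x' y' u v : Fin n → ℂ} {s : ℝ} (hdet : IsUnit (A s).det)
    (h : ∀ i j, HasDerivAt (fun t => A t i j) (wedge u v i j) s)
    (hx : ∀ i, HasDerivAt (fun t => x t i) (x' i) s)
    (hy : ∀ i, HasDerivAt (fun t => y t i) (y' i) s) :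
    HasDerivAt (fun t => bracket (A t) (x t) (y t))
      (bracket (A s) x' (y s) + bracket (A s) (x s) y' -
        (bracket (A s) (x s) u * bracket (A s) v (y s) -
          bracket (A s) (x s) v * bracket (A s) u (y s))) s := by
  have hG := hasDerivAt_inv_matrix hdet (hasDerivAt_matrix h)
  rw [← dotProduct_inv_wedge_inv]
  simp only [bracket_eq_sum]
  have := HasDerivAt.fun_sum (u := Finset.univ) fun i (_ : i ∈ Finset.univ) =>
    HasDerivAt.fun_sum (u := Finset.univ) fun j (_ : j ∈ Finset.univ) =>
      (hx i).mul ((hasDerivAt_matrix_apply hG i j).mul (hy j))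
  refine this.congr_deriv ?_
  simp only [dotProduct, mulVec, Finset.mul_sum, ← Finset.sum_add_distrib, ← Finset.sum_sub_distrib]
  refine Finset.sum_congr rfl fun i _ => Finset.sum_congr rfl fun j _ => ?_
  simp only [Matrix.neg_apply, Pi.mul_apply]
  ring

end Calculus

/-! ### The matrix of the tau function -/

/-- The conditions on the parameters of the soliton solution: non-degeneracy, and the reduction
condition coupling the indices `i` and `2N + 1 - i`. -/
structure IsReduced {N : ℕ} (b : ℝ) (p : Fin (2 * N) → ℂ)
    (c : Matrix (Fin (2 * N)) (Fin (2 * N)) ℂ) : Prop where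
  p_ne_zero : ∀ i, p i ≠ 0
  p_add_ne_zero : ∀ i j, i ≠ j → p i + p j ≠ 0
  one_sub_ne_zero : ∀ i, 1 - (b : ℂ) * p i ≠ 0
  one_add_ne_zero : ∀ i, 1 + (b : ℂ) * p i ≠ 0
  skew : ∀ i j, c i j = -c j i
  apply_eq_zero : ∀ i j, j ≠ Fin.rev i → c i j = 0
  reduction : ∀ i, p i ^ 3 * (1 - (b : ℂ) ^ 2 * p (Fin.rev i) ^ 2) =
    -(p (Fin.rev i) ^ 3 * (1 - (b : ℂ) ^ 2 * p i ^ 2))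

/-- The skew-symmetric matrix with entries `(i, j)_l`, whose Pfaffian is `τ_l`. -/
noncomputable def tauMatrix {N : ℕ} (b : ℝ) (p ξ : Fin (2 * N) → ℂ)
    (c : Matrix (Fin (2 * N)) (Fin (2 * N)) ℂ) (l : ℤ) (s : ℝ) :
    Matrix (Fin (2 * N)) (Fin (2 * N)) ℂ :=
  Matrix.of fun i j =>
    c i j + (p i - p j) / (p i + p j) * (phi b p ξ i l s * phi b p ξ j l s)

/-- The vector of the `n`-th derivatives `p_i⁻ⁿ φ_i(l)`. -/
noncomputable def phiVec {N : ℕ} (b : ℝ) (p ξ : Fin (2 * N) → ℂ) (n : ℕ) (l : ℤ) (s : ℝ) :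
    Fin (2 * N) → ℂ := fun i => (p i)⁻¹ ^ n * phi b p ξ i l s

/-- The vector `φ_i(l) / (p_i⁻¹ - b)`, which generates the shift `l → l + 1`. -/
noncomputable def shiftVec {N : ℕ} (b : ℝ) (p ξ : Fin (2 * N) → ℂ) (l : ℤ) (s : ℝ) :
    Fin (2 * N) → ℂ := fun i => phi b p ξ i l s / ((p i)⁻¹ - b)

/-- The dispersion relation `h = k ^ 3 - b ^ 2 k` at `k = 1 / p_i`. The reduction condition says
that `h_i + h_{2N + 1 - i} = 0`. -/
noncomputable def dispersion {N : ℕ} (b : ℝ) (p : Fin (2 * N) → ℂ) : Fin (2 * N) → ℂ :=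
  fun i => (p i)⁻¹ ^ 3 - (b : ℂ) ^ 2 * (p i)⁻¹

variable {N : ℕ} {b : ℝ} {p ξ : Fin (2 * N) → ℂ} {c : Matrix (Fin (2 * N)) (Fin (2 * N)) ℂ}

lemma tau_eq_pfaffian (l : ℤ) (s : ℝ) : tau b p ξ c l s = pfaffian (tauMatrix b p ξ c l s) := rfl

lemma IsReduced.inv_sub_ne_zero (H : IsReduced b p c) (i : Fin (2 * N)) :
    (p i)⁻¹ - (b : ℂ) ≠ 0 := by
  have h : (p i)⁻¹ - (b : ℂ) = (1 - b * p i) * (p i)⁻¹ := by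
    have := H.p_ne_zero i
    field_simp
  rw [h]
  exact mul_ne_zero (H.one_sub_ne_zero i) (inv_ne_zero (H.p_ne_zero i))

lemma IsReduced.transpose_tauMatrix (H : IsReduced b p c) (l : ℤ) (s : ℝ) :
    (tauMatrix b p ξ c l s)ᵀ = -tauMatrix b p ξ c l s := by
  ext i j
  simp only [tauMatrix, transpose_apply, Matrix.neg_apply, of_apply]
  rw [H.skew j i, add_comm (p j) (p i)]
  ring

/-- The Cauchy-type kernel of `τ`, in terms of `k = 1 / p`. -/
lemma IsReduced.kernel_mul (H : IsReduced b p c) (i j : Fin (2 * N)) :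
    (p i - p j) / (p i + p j) * ((p i)⁻¹ + (p j)⁻¹) = (p j)⁻¹ - (p i)⁻¹ := by
  rcases eq_or_ne i j with rfl | hij
  · simp
  · have h1 := H.p_ne_zero i
    have h2 := H.p_ne_zero j
    have h3 := H.p_add_ne_zero i j hij
    field_simp
    ring

lemma hasDerivAt_phi (i : Fin (2 * N)) (l : ℤ) (s : ℝ) :
    HasDerivAt (fun t => phi b p ξ i l t) ((p i)⁻¹ * phi b p ξ i l s) s := by
  have h1 : HasDerivAt (fun t : ℝ => (p i)⁻¹ * (t : ℂ) + ξ i) ((p i)⁻¹ * 1) s :=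
    ((HasDerivAt.ofReal_comp (hasDerivAt_id s)).const_mul _).add_const _
  refine (h1.cexp.const_mul (((1 + (b : ℂ) * p i) / (1 - (b : ℂ) * p i)) ^ l)).congr_deriv ?_
  rw [phi]
  ring

lemma hasDerivAt_phiVec (n : ℕ) (l : ℤ) (s : ℝ) (i : Fin (2 * N)) :
    HasDerivAt (fun t => phiVec b p ξ n l t i) (phiVec b p ξ (n + 1) l s i) s := by
  refine ((hasDerivAt_phi i l s).const_mul ((p i)⁻¹ ^ n)).congr_deriv ?_
  rw [phiVec]
  ring

lemma IsReduced.hasDerivAt_shiftVec (H : IsReduced b p c) (l : ℤ) (s : ℝ) (i : Fin (2 * N)) :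
    HasDerivAt (fun t => shiftVec b p ξ l t i)
      ((phiVec b p ξ 0 l s + (b : ℂ) • shiftVec b p ξ l s) i) s := by
  refine ((hasDerivAt_phi i l s).div_const ((p i)⁻¹ - b)).congr_deriv ?_
  have := H.inv_sub_ne_zero i
  simp only [phiVec, shiftVec, Pi.add_apply, Pi.smul_apply, smul_eq_mul, pow_zero, one_mul]
  rw [div_eq_iff this, add_mul, mul_assoc, div_mul_cancel₀ _ this]
  ring

lemma IsReduced.hasDerivAt_tauMatrix (H : IsReduced b p c) (l : ℤ) (s : ℝ) (i j : Fin (2 * N)) :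
    HasDerivAt (fun t => tauMatrix b p ξ c l t i j)
      (wedge (phiVec b p ξ 0 l s) (phiVec b p ξ 1 l s) i j) s := by
  refine ((((hasDerivAt_phi i l s).mul (hasDerivAt_phi j l s)).const_mul
    ((p i - p j) / (p i + p j))).const_add (c i j)).congr_deriv ?_
  simp only [wedge, Matrix.sub_apply, vecMulVec_apply, phiVec]
  linear_combination (phi b p ξ i l s * phi b p ξ j l s) * H.kernel_mul i j

lemma IsReduced.phi_succ (H : IsReduced b p c) (i : Fin (2 * N)) (l : ℤ) (s : ℝ) :
    phi b p ξ i (l + 1) s = phi b p ξ i l s + 2 * b * shiftVec b p ξ l s i := by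
  have h1 := H.one_sub_ne_zero i
  have h2 := H.one_add_ne_zero i
  have h3 := H.p_ne_zero i
  have h4 := H.inv_sub_ne_zero i
  have hw : (1 + (b : ℂ) * p i) / (1 - (b : ℂ) * p i) = 1 + 2 * b / ((p i)⁻¹ - b) := by
    have h : 1 - (b : ℂ) * p i = ((p i)⁻¹ - b) * p i := by field_simp
    rw [div_eq_iff h1, h, add_mul, one_mul, ← mul_assoc, div_mul_cancel₀ _ h4, ← h]
    ring
  rw [shiftVec, phi, phi, zpow_add_one₀ (div_ne_zero h2 h1)]
  set X := ((1 + (b : ℂ) * p i) / (1 - (b : ℂ) * p i)) ^ l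
  rw [hw]
  ring

/-- The shift `l → l + 1` is a rank two perturbation: with `k = 1 / p` it multiplies `φ_i` by
`(k_i + b) / (k_i - b)`, and the factor
`(k_i + b) (k_j + b) - (k_i - b) (k_j - b) = 2 b (k_i + k_j)` cancels the denominator of the
kernel. -/
lemma IsReduced.tauMatrix_succ (H : IsReduced b p c) (l : ℤ) (s : ℝ) :
    tauMatrix b p ξ c (l + 1) s = tauMatrix b p ξ c l s +
      wedge ((2 * (b : ℂ)) • shiftVec b p ξ l s) (phiVec b p ξ 0 l s) := by
  have hφ : ∀ i, phi b p ξ i l s = ((p i)⁻¹ - b) * shiftVec b p ξ l s i := fun i => by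
    rw [shiftVec, mul_div_cancel₀ _ (H.inv_sub_ne_zero i)]
  ext i j
  simp only [tauMatrix, of_apply, Matrix.add_apply, wedge, Matrix.sub_apply, vecMulVec_apply,
    phiVec, H.phi_succ, Pi.smul_apply, smul_eq_mul]
  rw [hφ i, hφ j]
  linear_combination (2 * b * shiftVec b p ξ l s i * shiftVec b p ξ l s j) * H.kernel_mul i j

/-! ### The reduction -/

lemma IsReduced.dispersion_add_rev (H : IsReduced b p c) (i : Fin (2 * N)) :
    dispersion b p i + dispersion b p (Fin.rev i) = 0 := by
  have h1 := H.p_ne_zero i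
  have h2 := H.p_ne_zero (Fin.rev i)
  have h := H.reduction i
  simp only [dispersion]
  field_simp
  linear_combination h

/-- The flow with the dispersion relation `h` does not see the constants `c_{ij}`, so that it acts
on the matrix of `τ` by a matrix of rank four. -/
lemma IsReduced.dispersion_tauMatrix (H : IsReduced b p c) (l : ℤ) (s : ℝ) :
    diagonal (dispersion b p) * tauMatrix b p ξ c l s +
        tauMatrix b p ξ c l s * diagonal (dispersion b p) =
      wedge (phiVec b p ξ 0 l s) (phiVec b p ξ 3 l s)
        - (2 : ℂ) • wedge (phiVec b p ξ 1 l s) (phiVec b p ξ 2 l s)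
        - ((b : ℂ) ^ 2) • wedge (phiVec b p ξ 0 l s) (phiVec b p ξ 1 l s) := by
  ext i j
  have hc : c i j * (dispersion b p i + dispersion b p j) = 0 := by
    by_cases hj : j = Fin.rev i
    · rw [hj, H.dispersion_add_rev, mul_zero]
    · rw [H.apply_eq_zero i j hj, zero_mul]
  simp only [Matrix.add_apply, diagonal_mul, mul_diagonal, tauMatrix, of_apply, wedge,
    Matrix.sub_apply, Matrix.smul_apply, vecMulVec_apply, phiVec, smul_eq_mul]
  simp only [dispersion] at hc ⊢
  linear_combination hc + (phi b p ξ i l s * phi b p ξ j l s) *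
    ((p i)⁻¹ ^ 2 - (p i)⁻¹ * (p j)⁻¹ + (p j)⁻¹ ^ 2 - (b : ℂ) ^ 2) * H.kernel_mul i j

lemma IsReduced.dispersion_shiftVec (H : IsReduced b p c) (l : ℤ) (s : ℝ) :
    diagonal (dispersion b p) *ᵥ shiftVec b p ξ l s =
      phiVec b p ξ 2 l s + (b : ℂ) • phiVec b p ξ 1 l s := by
  ext i
  have h := H.inv_sub_ne_zero i
  simp only [mulVec_diagonal, dispersion, shiftVec, phiVec, Pi.add_apply, Pi.smul_apply,
    smul_eq_mul]
  rw [mul_div_assoc', div_eq_iff h]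
  ring

lemma dispersion_phiVec (l : ℤ) (s : ℝ) :
    diagonal (dispersion b p) *ᵥ phiVec b p ξ 0 l s =
      phiVec b p ξ 3 l s - ((b : ℂ) ^ 2) • phiVec b p ξ 1 l s := by
  ext i
  simp only [mulVec_diagonal, dispersion, phiVec, Pi.sub_apply, Pi.smul_apply, smul_eq_mul]
  ring

/-- The relation `A⁻¹ D + D A⁻¹ = A⁻¹ (D A + A D) A⁻¹` for `D = diag h`, evaluated between the shift
vector `α` and `φ`. As `h = k (k + b) (k - b)`, the vector `D α` is a combination of `φ''` and `φ'`,
so that `⟨α, φ'''⟩` is expressed by the other brackets. -/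
lemma IsReduced.bracket_shiftVec (H : IsReduced b p c) {l : ℤ} {s : ℝ}
    (hdet : IsUnit (tauMatrix b p ξ c l s).det) :
    bracket (tauMatrix b p ξ c l s) (shiftVec b p ξ l s) (phiVec b p ξ 3 l s)
      - b ^ 2 * bracket (tauMatrix b p ξ c l s) (shiftVec b p ξ l s) (phiVec b p ξ 1 l s)
      - bracket (tauMatrix b p ξ c l s) (phiVec b p ξ 0 l s) (phiVec b p ξ 2 l s)
      - b * bracket (tauMatrix b p ξ c l s) (phiVec b p ξ 0 l s) (phiVec b p ξ 1 l s) =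
    -bracket (tauMatrix b p ξ c l s) (shiftVec b p ξ l s) (phiVec b p ξ 0 l s) *
        bracket (tauMatrix b p ξ c l s) (phiVec b p ξ 0 l s) (phiVec b p ξ 3 l s)
      + 2 * bracket (tauMatrix b p ξ c l s) (shiftVec b p ξ l s) (phiVec b p ξ 1 l s) *
        bracket (tauMatrix b p ξ c l s) (phiVec b p ξ 0 l s) (phiVec b p ξ 2 l s)
      - 2 * bracket (tauMatrix b p ξ c l s) (shiftVec b p ξ l s) (phiVec b p ξ 2 l s) *
        bracket (tauMatrix b p ξ c l s) (phiVec b p ξ 0 l s) (phiVec b p ξ 1 l s)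
      + b ^ 2 * bracket (tauMatrix b p ξ c l s) (shiftVec b p ξ l s) (phiVec b p ξ 0 l s) *
        bracket (tauMatrix b p ξ c l s) (phiVec b p ξ 0 l s) (phiVec b p ξ 1 l s) := by
  have hA := H.transpose_tauMatrix (ξ := ξ) l s
  have hM := H.dispersion_tauMatrix (ξ := ξ) l s
  have hα := H.dispersion_shiftVec (ξ := ξ) l s
  have hφ := dispersion_phiVec (b := b) (p := p) (ξ := ξ) l s
  generalize tauMatrix b p ξ c l s = A at *
  generalize shiftVec b p ξ l s = α at *
  generalize phiVec b p ξ 0 l s = φ₀ at *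
  generalize phiVec b p ξ 1 l s = φ₁ at *
  generalize phiVec b p ξ 2 l s = φ₂ at *
  generalize phiVec b p ξ 3 l s = φ₃ at *
  generalize diagonal (dispersion b p) = D, diagonal_transpose (dispersion b p) = hD at *
  have h1 : A⁻¹ * D + D * A⁻¹ = A⁻¹ * wedge φ₀ φ₃ * A⁻¹ - (2 : ℂ) • (A⁻¹ * wedge φ₁ φ₂ * A⁻¹)
      - ((b : ℂ) ^ 2) • (A⁻¹ * wedge φ₀ φ₁ * A⁻¹) := by
    have h := congrArg (fun M => A⁻¹ * M * A⁻¹) hM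
    simp only [mul_add, add_mul, mul_sub, sub_mul, Matrix.mul_smul, Matrix.smul_mul] at h
    rw [← h]
    congr 1
    · rw [← mul_assoc, mul_assoc (A⁻¹ * D), mul_nonsing_inv _ hdet, mul_one]
    · rw [← mul_assoc, nonsing_inv_mul _ hdet, one_mul]
  have h2 : bracket A α (D *ᵥ φ₀) + bracket A (D *ᵥ α) φ₀ =
      α ⬝ᵥ ((A⁻¹ * D + D * A⁻¹) *ᵥ φ₀) := by
    rw [add_mulVec, dotProduct_add, ← mulVec_mulVec, ← mulVec_mulVec, bracket, bracket,
      dotProduct_mulVec α D, ← mulVec_transpose, hD]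
  rw [h1, sub_mulVec, sub_mulVec, smul_mulVec, smul_mulVec, dotProduct_sub, dotProduct_sub,
    dotProduct_smul, dotProduct_smul, dotProduct_inv_wedge_inv, dotProduct_inv_wedge_inv,
    dotProduct_inv_wedge_inv, hφ, hα, bracket_sub_right, bracket_smul_right, bracket_add_left,
    bracket_smul_left, bracket_self hA, bracket_swap hA φ₁ φ₀, bracket_swap hA φ₂ φ₀,
    bracket_swap hA φ₃ φ₀] at h2
  simp only [smul_eq_mul] at h2
  linear_combination h2

/-! ### The bilinear equation -/

/-- The form `⟨φ⁽ᵐ⁾, φ⁽ⁿ⁾⟩` for the matrix of `τ_l`. -/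
noncomputable def phiBracket (b : ℝ) (p ξ : Fin (2 * N) → ℂ)
    (c : Matrix (Fin (2 * N)) (Fin (2 * N)) ℂ) (m n : ℕ) (l : ℤ) (s : ℝ) : ℂ :=
  bracket (tauMatrix b p ξ c l s) (phiVec b p ξ m l s) (phiVec b p ξ n l s)

/-- The form `⟨α, φ⁽ⁿ⁾⟩` for the matrix of `τ_l`, where `α` is the shift vector. -/
noncomputable def shiftBracket (b : ℝ) (p ξ : Fin (2 * N) → ℂ)
    (c : Matrix (Fin (2 * N)) (Fin (2 * N)) ℂ) (n : ℕ) (l : ℤ) (s : ℝ) : ℂ :=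
  bracket (tauMatrix b p ξ c l s) (shiftVec b p ξ l s) (phiVec b p ξ n l s)

local notation "w" => phiBracket b p ξ c
local notation "a" => shiftBracket b p ξ c

lemma IsReduced.isUnit_det (H : IsReduced b p c) {l : ℤ} {s : ℝ} (h : tau b p ξ c l s ≠ 0) :
    IsUnit (tauMatrix b p ξ c l s).det :=
  isUnit_det_of_pfaffian_ne_zero (H.transpose_tauMatrix l s) h

lemma IsReduced.hasDerivAt_phiBracket (H : IsReduced b p c) (m n : ℕ) {l : ℤ} {s : ℝ}
    (h : tau b p ξ c l s ≠ 0) :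
    HasDerivAt (w m n l) (w (m + 1) n l s + w m (n + 1) l s
      - (w m 0 l s * w 1 n l s - w m 1 l s * w 0 n l s)) s :=
  hasDerivAt_bracket (H.isUnit_det h) (H.hasDerivAt_tauMatrix l s) (hasDerivAt_phiVec m l s)
    (hasDerivAt_phiVec n l s)

lemma IsReduced.hasDerivAt_shiftBracket (H : IsReduced b p c) (n : ℕ) {l : ℤ} {s : ℝ}
    (h : tau b p ξ c l s ≠ 0) :
    HasDerivAt (a n l) (w 0 n l s + b * a n l s + a (n + 1) l s
      - (a 0 l s * w 1 n l s - a 1 l s * w 0 n l s)) s := by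
  refine (hasDerivAt_bracket (H.isUnit_det h) (H.hasDerivAt_tauMatrix l s)
    (H.hasDerivAt_shiftVec l s) (hasDerivAt_phiVec n l s)).congr_deriv ?_
  rw [bracket_add_left, bracket_smul_left]
  rfl

lemma IsReduced.phiBracket_self (H : IsReduced b p c) (n : ℕ) (l : ℤ) (s : ℝ) :
    w n n l s = 0 := bracket_self (H.transpose_tauMatrix l s) _

lemma IsReduced.phiBracket_swap (H : IsReduced b p c) (m n : ℕ) (l : ℤ) (s : ℝ) :
    w m n l s = -w n m l s := bracket_swap (H.transpose_tauMatrix l s) _ _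

lemma IsReduced.hasDerivAt_phiBracket_zero_one (H : IsReduced b p c) {l : ℤ} {s : ℝ}
    (h : tau b p ξ c l s ≠ 0) :
    HasDerivAt (w 0 1 l) (w 0 2 l s + w 0 1 l s ^ 2) s := by
  refine (H.hasDerivAt_phiBracket 0 1 h).congr_deriv ?_
  rw [H.phiBracket_self 0, H.phiBracket_self (0 + 1)]
  ring

lemma IsReduced.hasDerivAt_phiBracket_zero_two (H : IsReduced b p c) {l : ℤ} {s : ℝ}
    (h : tau b p ξ c l s ≠ 0) :
    HasDerivAt (w 0 2 l) (w 1 2 l s + w 0 3 l s + w 0 1 l s * w 0 2 l s) s := by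
  refine (H.hasDerivAt_phiBracket 0 2 h).congr_deriv ?_
  rw [H.phiBracket_self 0]
  ring

/-- The first derivative of `⟨α, φ⟩`. -/
noncomputable def shiftDeriv₁ (b : ℝ) (p ξ : Fin (2 * N) → ℂ)
    (c : Matrix (Fin (2 * N)) (Fin (2 * N)) ℂ) (l : ℤ) (s : ℝ) : ℂ :=
  b * shiftBracket b p ξ c 0 l s + shiftBracket b p ξ c 1 l s
    + shiftBracket b p ξ c 0 l s * phiBracket b p ξ c 0 1 l s

/-- The first derivative of `⟨α, φ'⟩`. -/
noncomputable def shiftDerivOne (b : ℝ) (p ξ : Fin (2 * N) → ℂ)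
    (c : Matrix (Fin (2 * N)) (Fin (2 * N)) ℂ) (l : ℤ) (s : ℝ) : ℂ :=
  phiBracket b p ξ c 0 1 l s + b * shiftBracket b p ξ c 1 l s + shiftBracket b p ξ c 2 l s
    + shiftBracket b p ξ c 1 l s * phiBracket b p ξ c 0 1 l s

/-- The second derivative of `⟨α, φ⟩`. -/
noncomputable def shiftDeriv₂ (b : ℝ) (p ξ : Fin (2 * N) → ℂ)
    (c : Matrix (Fin (2 * N)) (Fin (2 * N)) ℂ) (l : ℤ) (s : ℝ) : ℂ :=
  b * shiftDeriv₁ b p ξ c l s + shiftDerivOne b p ξ c l s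
    + (shiftDeriv₁ b p ξ c l s * phiBracket b p ξ c 0 1 l s
      + shiftBracket b p ξ c 0 l s * (phiBracket b p ξ c 0 2 l s + phiBracket b p ξ c 0 1 l s ^ 2))

lemma IsReduced.hasDerivAt_shiftBracket_zero (H : IsReduced b p c) {l : ℤ} {s : ℝ}
    (h : tau b p ξ c l s ≠ 0) :
    HasDerivAt (a 0 l) (shiftDeriv₁ b p ξ c l s) s := by
  refine (H.hasDerivAt_shiftBracket 0 h).congr_deriv ?_
  rw [H.phiBracket_self 0, H.phiBracket_swap 1 0, shiftDeriv₁]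
  ring

lemma IsReduced.hasDerivAt_shiftBracket_one (H : IsReduced b p c) {l : ℤ} {s : ℝ}
    (h : tau b p ξ c l s ≠ 0) :
    HasDerivAt (a 1 l) (shiftDerivOne b p ξ c l s) s := by
  refine (H.hasDerivAt_shiftBracket 1 h).congr_deriv ?_
  rw [H.phiBracket_self 1, shiftDerivOne]
  ring

lemma IsReduced.hasDerivAt_shiftDeriv₁ (H : IsReduced b p c) {l : ℤ} {s : ℝ}
    (h : tau b p ξ c l s ≠ 0) :
    HasDerivAt (shiftDeriv₁ b p ξ c l) (shiftDeriv₂ b p ξ c l s) s :=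
  (((H.hasDerivAt_shiftBracket_zero h).const_mul (b : ℂ)).add
    (H.hasDerivAt_shiftBracket_one h)).add
      ((H.hasDerivAt_shiftBracket_zero h).mul (H.hasDerivAt_phiBracket_zero_one h))

/-- The bilinear equation `(D³ - 3 b D² + 2 b² D) τ_{l+1} · τ_l = 0`, divided by `-2 b τ_l²`:
with `r = ⟨α, φ⟩`, `R = τ_{l+1} / τ_l = 1 - 2 b r` and `F = (ln τ_l)'' = -(w₀₂ + w₀₁²)`, where
`w_{mn} = ⟨φ⁽ᵐ⁾, φ⁽ⁿ⁾⟩`, it reads `r''' + 6 F r' - 3 b r'' + 2 b² r' + 3 F R = 0`. In this form it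
holds for `b = 0` too. -/
theorem IsReduced.hasDerivAt_shiftDeriv₂ (H : IsReduced b p c) {l : ℤ} {s : ℝ}
    (h : tau b p ξ c l s ≠ 0) :
    HasDerivAt (shiftDeriv₂ b p ξ c l)
      (6 * (w 0 2 l s + w 0 1 l s ^ 2) * shiftDeriv₁ b p ξ c l s
        + 3 * b * shiftDeriv₂ b p ξ c l s - 2 * b ^ 2 * shiftDeriv₁ b p ξ c l s
        + 3 * (w 0 2 l s + w 0 1 l s ^ 2) * (1 - 2 * b * a 0 l s)) s := by
  have hr := H.hasDerivAt_shiftBracket_zero h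
  have hr₁ := H.hasDerivAt_shiftDeriv₁ h
  have ha₁ := H.hasDerivAt_shiftBracket_one h
  have ha₂ := H.hasDerivAt_shiftBracket 2 h
  have hw₁ := H.hasDerivAt_phiBracket_zero_one h
  have hw₂ := H.hasDerivAt_phiBracket_zero_two h
  have hone : HasDerivAt (shiftDerivOne b p ξ c l) _ s :=
    ((hw₁.add (ha₁.const_mul (b : ℂ))).add ha₂).add (ha₁.mul hw₁)
  have hall : HasDerivAt (shiftDeriv₂ b p ξ c l) _ s :=
    ((hr₁.const_mul (b : ℂ)).add hone).add ((hr₁.mul hw₁).add (hr.mul (hw₂.add (hw₁.pow 2))))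
  refine hall.congr_deriv ?_
  have hE : a 3 l s - b ^ 2 * a 1 l s - w 0 2 l s - b * w 0 1 l s =
      -a 0 l s * w 0 3 l s + 2 * a 1 l s * w 0 2 l s - 2 * a 2 l s * w 0 1 l s
        + b ^ 2 * a 0 l s * w 0 1 l s := H.bracket_shiftVec (H.isUnit_det h)
  simp only [shiftDeriv₂, shiftDerivOne, shiftDeriv₁]
  push_cast
  linear_combination hE

/-! ### The tau functions at neighbouring sites -/

lemma IsReduced.hasDerivAt_tau (H : IsReduced b p c) {l : ℤ} {s : ℝ} (h : tau b p ξ c l s ≠ 0) :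
    HasDerivAt (tau b p ξ c l) (-w 0 1 l s * tau b p ξ c l s) s :=
  hasDerivAt_pfaffian (H.transpose_tauMatrix l s) (H.isUnit_det h) (H.hasDerivAt_tauMatrix l s)

lemma IsReduced.tau_succ (H : IsReduced b p c) {l : ℤ} {s : ℝ} (h : tau b p ξ c l s ≠ 0) :
    tau b p ξ c (l + 1) s = tau b p ξ c l s * (1 - 2 * b * a 0 l s) := by
  rw [tau_eq_pfaffian, H.tauMatrix_succ, pfaffian_add_wedge (H.transpose_tauMatrix l s)
    (H.isUnit_det h), bracket_smul_left]
  rfl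

lemma IsReduced.eventually_tau_ne_zero (H : IsReduced b p c) {l : ℤ} {s : ℝ}
    (h : tau b p ξ c l s ≠ 0) : ∀ᶠ t in 𝓝 s, tau b p ξ c l t ≠ 0 :=
  (H.hasDerivAt_tau h).continuousAt.eventually_ne h

lemma IsReduced.logDeriv_tau (H : IsReduced b p c) {l : ℤ} {s : ℝ} (h : tau b p ξ c l s ≠ 0) :
    logDeriv (tau b p ξ c l) s = -w 0 1 l s := by
  rw [logDeriv_apply, (H.hasDerivAt_tau h).deriv, mul_div_cancel_right₀ _ h]

lemma IsReduced.hasDerivAt_logDeriv_tau (H : IsReduced b p c) {l : ℤ} {s : ℝ}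
    (h : tau b p ξ c l s ≠ 0) :
    HasDerivAt (logDeriv (tau b p ξ c l)) (-(w 0 2 l s + w 0 1 l s ^ 2)) s :=
  (H.hasDerivAt_phiBracket_zero_one h).neg.congr_of_eventuallyEq
    ((H.eventually_tau_ne_zero h).mono fun _ ht => H.logDeriv_tau ht)

lemma IsReduced.uOf_eq (H : IsReduced b p c) {l : ℤ} {s : ℝ} (h : tau b p ξ c l s ≠ 0) :
    uOf (tau b p ξ c) l s = 2 * (w 0 2 l s + w 0 1 l s ^ 2) := by
  rw [uOf, (H.hasDerivAt_logDeriv_tau h).deriv]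
  ring

lemma IsReduced.hasDerivAt_xOf (H : IsReduced b p c) {l : ℤ} {s : ℝ} (h : tau b p ξ c l s ≠ 0) :
    HasDerivAt (xOf b (tau b p ξ c) l) (uOf (tau b p ξ c) l s) s := by
  refine (((H.hasDerivAt_logDeriv_tau h).const_mul 2).const_sub _).congr_deriv ?_
  rw [H.uOf_eq h]
  ring

lemma IsReduced.hasDerivAt_meshOf (H : IsReduced b p c) {l : ℤ} {s : ℝ}
    (h : tau b p ξ c l s ≠ 0) (h' : tau b p ξ c (l + 1) s ≠ 0) :
    HasDerivAt (meshOf (xOf b (tau b p ξ c)) l)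
      (uOf (tau b p ξ c) (l + 1) s - uOf (tau b p ξ c) l s) s :=
  (H.hasDerivAt_xOf h').sub (H.hasDerivAt_xOf h)

lemma IsReduced.ratio_ne_zero (H : IsReduced b p c) {l : ℤ} {s : ℝ}
    (h : tau b p ξ c l s ≠ 0) (h' : tau b p ξ c (l + 1) s ≠ 0) : 1 - 2 * b * a 0 l s ≠ 0 := by
  rw [H.tau_succ h] at h'
  exact right_ne_zero_of_mul h'

lemma IsReduced.hasDerivAt_ratio (H : IsReduced b p c) {l : ℤ} {s : ℝ}
    (h : tau b p ξ c l s ≠ 0) :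
    HasDerivAt (fun t => 1 - 2 * b * a 0 l t) (-(2 * b * shiftDeriv₁ b p ξ c l s)) s :=
  ((H.hasDerivAt_shiftBracket_zero h).const_mul (2 * (b : ℂ))).const_sub 1

lemma IsReduced.meshOf_eq (H : IsReduced b p c) {l : ℤ} {s : ℝ}
    (h : tau b p ξ c l s ≠ 0) (h' : tau b p ξ c (l + 1) s ≠ 0) :
    meshOf (xOf b (tau b p ξ c)) l s =
      2 * b + 4 * b * (shiftDeriv₁ b p ξ c l s / (1 - 2 * b * a 0 l s)) := by
  have hR := H.ratio_ne_zero h h'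
  have hd : HasDerivAt (tau b p ξ c (l + 1)) _ s :=
    ((H.hasDerivAt_tau h).mul (H.hasDerivAt_ratio h)).congr_of_eventuallyEq
      ((H.eventually_tau_ne_zero h).mono fun t ht => H.tau_succ ht)
  have hl : logDeriv (tau b p ξ c (l + 1)) s =
      -w 0 1 l s - 2 * b * (shiftDeriv₁ b p ξ c l s / (1 - 2 * b * a 0 l s)) := by
    rw [logDeriv_apply, hd.deriv, H.tau_succ h]
    field_simp
    ring
  rw [meshOf, xOf, xOf, hl, H.logDeriv_tau h]
  push_cast
  ring

/-- Both sides are the derivative of the mesh `δ_l`, the right one by `IsReduced.meshOf_eq`. -/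
lemma IsReduced.uOf_succ_sub (H : IsReduced b p c) {l : ℤ} {s : ℝ}
    (h : tau b p ξ c l s ≠ 0) (h' : tau b p ξ c (l + 1) s ≠ 0) :
    uOf (tau b p ξ c) (l + 1) s - uOf (tau b p ξ c) l s =
      4 * b * (shiftDeriv₂ b p ξ c l s / (1 - 2 * b * a 0 l s)
        + 2 * b * (shiftDeriv₁ b p ξ c l s / (1 - 2 * b * a 0 l s)) ^ 2) := by
  have hR := H.ratio_ne_zero h h'
  have h1 := (((H.hasDerivAt_shiftDeriv₁ h).fun_div (H.hasDerivAt_ratio h) hR).const_mul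
    (4 * (b : ℂ))).const_add (2 * (b : ℂ))
  have h2 := h1.congr_of_eventuallyEq
    (((H.eventually_tau_ne_zero h).and (H.eventually_tau_ne_zero h')).mono
      fun t ht => H.meshOf_eq ht.1 ht.2)
  rw [(H.hasDerivAt_meshOf h h').unique h2]
  field_simp
  ring

/-! ### The two semi-discrete systems -/

/-- Written in terms of `R = τ_{l+1} / τ_l`, the Ostrovsky equation is the bilinear equation. -/
theorem IsReduced.solvesOstrovskyAt (H : IsReduced b p c) {l : ℤ} {s : ℝ}
    (h : tau b p ξ c l s ≠ 0) (h' : tau b p ξ c (l + 1) s ≠ 0) :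
    SolvesOstrovskyAt b (meshOf (xOf b (tau b p ξ c))) (uOf (tau b p ξ c)) l s := by
  refine ⟨?_, H.hasDerivAt_meshOf h h'⟩
  have hR := H.ratio_ne_zero h h'
  have hR' := H.hasDerivAt_ratio h
  have h1 := (((H.hasDerivAt_shiftDeriv₂ h).fun_div hR' hR).add
    ((((H.hasDerivAt_shiftDeriv₁ h).fun_div hR' hR).fun_pow 2).const_mul (2 * (b : ℂ)))).const_mul
      (4 * (b : ℂ))
  have h2 := h1.congr_of_eventuallyEq
    (((H.eventually_tau_ne_zero h).and (H.eventually_tau_ne_zero h')).mono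
      fun t ht => H.uOf_succ_sub ht.1 ht.2)
  refine h2.congr_deriv ?_
  have h3 := H.uOf_succ_sub h h'
  rw [show uOf (tau b p ξ c) l s + uOf (tau b p ξ c) (l + 1) s = 2 * uOf (tau b p ξ c) l s +
    (uOf (tau b p ξ c) (l + 1) s - uOf (tau b p ξ c) l s) by ring, h3, H.uOf_eq h,
    H.meshOf_eq h h']
  generalize hRR : 1 - 2 * (b : ℂ) * a 0 l s = R at *
  simp only [Nat.reduceSub, pow_one]
  push_cast
  field_simp
  ring

/-- The Degasperis-Procesi system at the site `l` follows from the Ostrovsky equation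
at `l - 1` and `l`. -/
theorem SolvesOstrovskyAt.solvesDPAt {b : ℝ} {δ u : ℤ → ℝ → ℂ} {l : ℤ} {s : ℝ}
    (h₀ : SolvesOstrovskyAt b δ u (l - 1) s) (h₁ : SolvesOstrovskyAt b δ u l s)
    (hδ₀ : δ (l - 1) s ≠ 0) (hδ₁ : δ l s ≠ 0) (hδ : δ (l - 1) s + δ l s ≠ 0) :
    SolvesDPAt (mOf δ u) δ u l s := by
  refine ⟨?_, h₁.2, rfl⟩
  obtain ⟨hu₀, hd₀⟩ := h₀
  obtain ⟨hu₁, hd₁⟩ := h₁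
  rw [sub_add_cancel] at hu₀ hd₀
  have hδ' : δ l s + δ (l - 1) s ≠ 0 := by rwa [add_comm]
  have hD₁ : HasDerivAt (diffOp δ u l) _ s := hu₁.fun_div hd₁ hδ₁
  have hD₀ : HasDerivAt (diffOp δ u (l - 1)) _ s :=
    (hu₀.fun_div hd₀ hδ₀).congr_of_eventuallyEq
      (Eventually.of_forall fun t => by rw [diffOp, sub_add_cancel])
  have hm : HasDerivAt (mOf δ u l) _ s :=
    (((hasDerivAt_const s (2 : ℂ)).fun_div (hd₁.fun_add hd₀) hδ').mul
      (hD₁.neg.add hD₀)).add_const 1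
  refine hm.congr_deriv ?_
  simp only [mOf, avgOp, diffOp, sub_add_cancel, Pi.add_apply, Pi.neg_apply]
  have hM : (δ l s + δ (l - 1) s) / 2 ≠ 0 := div_ne_zero hδ' two_ne_zero
  generalize δ l s = d at *
  generalize δ (l - 1) s = e at *
  generalize u (l + 1) s = u₂ at *
  generalize u l s = u₁ at *
  generalize u (l - 1) s = u₀ at *
  field_simp
  ring

end ShortWaveDP

theorem mainTheorem1 (N : ℕ) (b : ℝ) (p ξ : Fin (2 * N) → ℂ)
    (c : Matrix (Fin (2 * N)) (Fin (2 * N)) ℂ)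
    (hp : ∀ i, p i ≠ 0)
    (hpp : ∀ i j, i ≠ j → p i + p j ≠ 0)
    (hb₁ : ∀ i, 1 - (b : ℂ) * p i ≠ 0)
    (hb₂ : ∀ i, 1 + (b : ℂ) * p i ≠ 0)
    (hc : ∀ i j, c i j = -c j i)
    (hc₀ : ∀ i j, j ≠ Fin.rev i → c i j = 0)
    (hred : ∀ i, p i ^ 3 * (1 - (b : ℂ) ^ 2 * p (Fin.rev i) ^ 2) =
      -(p (Fin.rev i) ^ 3 * (1 - (b : ℂ) ^ 2 * p i ^ 2)))
    (τ x u δ m : ℤ → ℝ → ℂ)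
    (hτ : τ = ShortWaveDP.tau b p ξ c)
    (hx : x = ShortWaveDP.xOf b τ)
    (hu : u = ShortWaveDP.uOf τ)
    (hδ : δ = ShortWaveDP.meshOf x)
    (hm : m = ShortWaveDP.mOf δ u) :
    (∀ (l : ℤ) (s : ℝ), τ (l - 1) s ≠ 0 → τ l s ≠ 0 → τ (l + 1) s ≠ 0 →
      δ (l - 1) s ≠ 0 → δ l s ≠ 0 → δ (l - 1) s + δ l s ≠ 0 →
      ShortWaveDP.SolvesDPAt m δ u l s) ∧
    (∀ (l : ℤ) (s : ℝ), τ l s ≠ 0 → τ (l + 1) s ≠ 0 →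
      ShortWaveDP.SolvesOstrovskyAt b δ u l s) := by
  have H : ShortWaveDP.IsReduced b p c := ⟨hp, hpp, hb₁, hb₂, hc, hc₀, hred⟩
  subst hm hδ hu hx hτ
  refine ⟨fun l s h₀ h₁ h₂ hδ₀ hδ₁ hδ => ?_, fun l s h h' => H.solvesOstrovskyAt h h'⟩
  exact ShortWaveDP.SolvesOstrovskyAt.solvesDPAt
    (H.solvesOstrovskyAt h₀ (by rwa [sub_add_cancel])) (H.solvesOstrovskyAt h₁ h₂) hδ₀ hδ₁ hδ
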